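/- For a metric space $(X,d)$ and $s>0$, the $s$-multiplicity of a family of subsets of $X$ is the least $m\ge 0$ such that every subset of $X$ of diameter $\le s$ meets at most $m$ members of the family. The Nagata dimension $\operatorname{ndim} X$ is the infimum of all integers $n$ for which there is a constant $c>0$ such that, for every $s>0$, $X$ has a covering by sets of diameter at most $cs$ with $s$-multiplicity at most $n+1$. Subsets of $\mathbb C$ carry the Euclidean metric. Theorem. Let $f:\mathbb C\to\mathbb C$ be an entire function with an essential singularity at $\infty$, and let $Y\subset\mathbb C$ be any nonempty set. Then there is a countable set $X\subset\mathbb C$ with $\operatorname{ndim} X=0$ such that $Y\subset\overline{f(X)}$ and $\operatorname{ndim} f(X)=\operatorname{ndim} Y$. If no isolated point of $Y$ is a value omitted by $f$, then moreover $f(X)\subset Y$, so that $f(X)$ is a dense subset of $Y$. In addition, $X$ can be chosen so that the moduli of its points grow geometrically: for any two distinct points $x,x'\in X$, either $|x'|\ge 2|x|$ or $|x|\ge 2|x'|$. -/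

import Mathlib

open Topology Filter

/-- A family `𝓑` of subsets of a metric space is `r`-bounded if each member has diameter `≤ r`. -/
def IsBoundedFamily {X : Type*} [MetricSpace X] (r : ℝ) (𝓑 : Set (Set X)) : Prop :=
  ∀ B ∈ 𝓑, Metric.ediam B ≤ ENNReal.ofReal r

/-- The `s`-multiplicity of a family `𝓑` of subsets of a metric space: the infimum of all `n ≥ 0`
such that every subset of diameter `≤ s` meets at most `n` members of `𝓑`
(`⊤` if there is no such `n`). -/
noncomputable def familyMultiplicity {X : Type*} [MetricSpace X] (s : ℝ) (𝓑 : Set (Set X)) : ℕ∞ :=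
  sInf {n : ℕ∞ | ∀ A : Set X, Metric.ediam A ≤ ENNReal.ofReal s →
    {B ∈ 𝓑 | (B ∩ A).Nonempty}.encard ≤ n}

/-- The defining property of the integers `n` over which the Nagata dimension is the infimum:
for some `c > 0` and all `s > 0`, the space has a `c * s`-bounded covering with `s`-multiplicity
at most `n + 1`. -/
def HasNagataCoverings (X : Type*) [MetricSpace X] (n : ℤ) : Prop :=
  ∃ c : ℝ, 0 < c ∧ ∀ s : ℝ, 0 < s → ∃ 𝓑 : Set (Set X),
    ⋃₀ 𝓑 = Set.univ ∧ IsBoundedFamily (c * s) 𝓑 ∧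
      ∃ m : ℕ, familyMultiplicity s 𝓑 = m ∧ (m : ℤ) ≤ n + 1

/-- The Nagata (or Assouad–Nagata) dimension of a metric space. It is `⊤` if no integer has the
defining property, and `-1` for the empty space. -/
noncomputable def nagataDim (X : Type*) [MetricSpace X] : EReal :=
  ⨅ (n : ℤ) (_ : HasNagataCoverings X n), ((n : ℝ) : EReal)

/-- `f` has an essential singularity at `∞`: the function `z ↦ f (1 / z)` is analytic in a punctured
neighbourhood of `0`, and its isolated singularity at `0` is neither removable nor a pole. -/
def HasEssentialSingularityAtInfinity (f : ℂ → ℂ) : Prop :=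
  (∀ᶠ z in 𝓝[≠] (0 : ℂ), AnalyticAt ℂ (fun w : ℂ => f w⁻¹) z) ∧
    ¬ MeromorphicAt (fun w : ℂ => f w⁻¹) 0

/-! By the great Picard theorem `f` takes every value, with at most one exception `a`, at points of
arbitrarily large modulus. Preimages of a countable dense `D ⊆ Y` can thus be picked one after
another, each of more than twice the modulus of the one before. Geometric growth alone forces Nagata
dimension zero (`hasCovering_of_geometric`). Nagata coverings pass to subsets and, with a worse
constant, to closures, so `f '' X ⊆ Y ⊆ closure (f '' X)` gives equal dimensions.

The exception costs little. If `a` is attained, a single preimage is put in front of the others; if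
`a` is an accumulation point of `Y`, it can be dropped from `D`. If `a` is omitted and isolated in
`Y`, a sequence of other values converging geometrically to `a` replaces it, and
`HasNagataCoverings.replace_isolated` shows that this does not raise the dimension.

Picard follows from Bloch: a function on a disc omitting `0` and `1` is `exp (2πi cosh² g)`, where
`g` misses a relatively dense set and so has bounded derivative. This gives Schottky's bound, which
bounds `f` on circles through points where `f` is near `2`; the maximum principle and Liouville
conclude. -/

/-! ### Bloch's theorem and the great Picard theorem for entire functions -/

/-- If `‖g'‖ ≤ 2 ‖g' z‖` on a disc around `z`, then the image of `g` contains an explicit disc. -/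
lemma ball_subset_image_of_norm_deriv_le {g : ℂ → ℂ} {z : ℂ} {r : ℝ} (hr : 0 < r)
    (hg : DifferentiableOn ℂ g (Metric.ball z r)) (h0 : deriv g z ≠ 0)
    (hb : ∀ w ∈ Metric.ball z r, ‖deriv g w‖ ≤ 2 * ‖deriv g z‖) :
    Metric.ball (g z) (‖deriv g z‖ * r / 24) ⊆ g '' Metric.closedBall z (r / 6) := by
  set a := deriv g z with ha
  have hapos : 0 < ‖a‖ := norm_pos_iff.2 h0
  have hsub : Metric.closedBall z (r / 6) ⊆ Metric.ball z r :=
    Metric.closedBall_subset_ball (by linarith)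
  -- Schwarz lemma for `deriv g`, which stays within `3‖a‖` of `a`; the radius `r / 6` turns this
  -- into `‖a‖ / 2`.
  have hderiv : ∀ w ∈ Metric.closedBall z (r / 6), ‖deriv g w - a‖ ≤ ‖a‖ / 2 := by
    intro w hw
    have hmaps : Set.MapsTo (deriv g) (Metric.ball z r)
        (Metric.closedBall (deriv g z) (3 * ‖a‖)) := by
      intro u hu
      rw [mem_closedBall_iff_norm]
      calc ‖deriv g u - deriv g z‖ ≤ ‖deriv g u‖ + ‖a‖ := norm_sub_le _ _
        _ ≤ 3 * ‖a‖ := by linarith [hb u hu]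
    have h := Complex.dist_le_div_mul_dist_of_mapsTo_ball (hg.deriv Metric.isOpen_ball) hmaps
      (hsub hw)
    rw [dist_eq_norm] at h
    calc ‖deriv g w - a‖ ≤ 3 * ‖a‖ / r * dist w z := h
      _ ≤ 3 * ‖a‖ / r * (r / 6) := by gcongr; exact Metric.mem_closedBall.1 hw
      _ = ‖a‖ / 2 := by field_simp; norm_num
  have hlin : ∀ w ∈ Metric.closedBall z (r / 6), ‖g w - g z - a * (w - z)‖ ≤ ‖a‖ / 2 * ‖w - z‖ := by
    intro w hw
    have h := (convex_closedBall z (r / 6)).norm_image_sub_le_of_norm_hasDerivWithin_le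
      (f := fun u => g u - a * u) (f' := fun u => deriv g u - a) (C := ‖a‖ / 2)
      (fun u hu => by
        have h1 := (hg.differentiableAt (Metric.isOpen_ball.mem_nhds (hsub hu))).hasDerivAt
        have h2 : HasDerivAt (fun u => g u - a * u) (deriv g u - a * 1) u :=
          h1.sub ((hasDerivAt_id u).const_mul a)
        rw [mul_one] at h2
        exact h2.hasDerivWithinAt)
      hderiv (Metric.mem_closedBall_self (by positivity)) hw
    rwa [show g w - g z - a * (w - z) = g w - a * w - (g z - a * z) by ring]
  have hdc : DiffContOnCl ℂ g (Metric.ball z (r / 6)) := by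
    refine ⟨hg.mono (Metric.ball_subset_closedBall.trans hsub), ?_⟩
    exact hg.continuousOn.mono (Metric.closure_ball_subset_closedBall.trans hsub)
  -- On the sphere `‖g w - g z‖ ≥ ‖a‖ r / 6 - ‖a‖ r / 12`, which is `ε`; the disc covered has radius
  -- `ε / 2`.
  have := hdc.ball_subset_image_closedBall (ε := ‖a‖ * r / 12) (by positivity) (fun w hw => ?_) ?_
  · convert this using 2
    ring
  · have h1 := hlin w (Metric.sphere_subset_closedBall hw)
    have hwz : ‖w - z‖ = r / 6 := by simpa [dist_eq_norm] using hw
    have h2 : ‖a * (w - z)‖ ≤ ‖g w - g z‖ + ‖g w - g z - a * (w - z)‖ := by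
      calc ‖a * (w - z)‖ = ‖(g w - g z) - (g w - g z - a * (w - z))‖ := by congr 1; ring
        _ ≤ _ := norm_sub_le _ _
    rw [norm_mul, hwz] at h2
    rw [hwz] at h1
    nlinarith
  · intro hev
    apply h0
    have : g =ᶠ[𝓝 z] fun _ => g z := hev.mono fun w hw => not_not.1 hw
    rw [ha, this.deriv_eq]
    simp

/-- A form of **Bloch's theorem**: if the image of `g` contains no disc of radius `D`, then the
derivative of `g` is bounded in terms of `D` and the distance to the boundary. -/
lemma norm_deriv_mul_le_of_not_ball_subset {g : ℂ → ℂ} {c : ℂ} {ρ D : ℝ} {U : Set ℂ}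
    (hU : IsOpen U) (hρ : 0 < ρ) (hD : 0 < D) (hcU : Metric.closedBall c ρ ⊆ U)
    (hg : DifferentiableOn ℂ g U) (homit : ∀ w, ¬ Metric.ball w D ⊆ g '' U) :
    ‖deriv g c‖ * ρ ≤ 48 * D := by
  -- Landau's trick: maximise the derivative weighted by the distance to the boundary. Within half
  -- that distance of a maximum point `z` the weight at most halves, so `‖deriv g‖ ≤ 2 ‖deriv g z‖`
  -- there. The halving turns `24` into `48`.
  have hcont : ContinuousOn (fun w => ‖deriv g w‖ * (ρ - dist w c)) (Metric.closedBall c ρ) :=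
    (((hg.deriv hU).continuousOn.mono hcU).norm).mul (by fun_prop)
  obtain ⟨z, hz, hmax⟩ := (isCompact_closedBall c ρ).exists_isMaxOn
    ⟨c, Metric.mem_closedBall_self hρ.le⟩ hcont
  have hmax' : ∀ w ∈ Metric.closedBall c ρ,
    ‖deriv g w‖ * (ρ - dist w c) ≤ ‖deriv g z‖ * (ρ - dist z c) := fun w hw => hmax hw
  have hc := hmax' c (Metric.mem_closedBall_self hρ.le)
  rw [dist_self, sub_zero] at hc
  by_contra! hlt
  have hpos : 0 < ‖deriv g z‖ * (ρ - dist z c) := by linarith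
  have hzρ : dist z c ≤ ρ := hz
  have ht : 0 < ρ - dist z c := by
    rcases hzρ.lt_or_eq with h | h
    · linarith
    · rw [h] at hpos; simp at hpos
  set t := (ρ - dist z c) / 2 with ht'
  have htpos : 0 < t := by positivity
  have hsub : Metric.ball z t ⊆ Metric.closedBall c ρ := by
    intro w hw
    have := dist_triangle w z c
    rw [Metric.mem_ball] at hw
    rw [Metric.mem_closedBall]
    linarith
  have hz0 : deriv g z ≠ 0 := by
    intro h; rw [h] at hpos; simp at hpos
  have key := ball_subset_image_of_norm_deriv_le htpos (hg.mono (hsub.trans hcU)) hz0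
    (fun w hw => by
      have h1 := hmax' w (hsub hw)
      have h2 := dist_triangle w z c
      rw [Metric.mem_ball] at hw
      have h3 : t ≤ ρ - dist w c := by linarith
      have h4 : ‖deriv g w‖ * t ≤ 2 * ‖deriv g z‖ * t :=
        calc ‖deriv g w‖ * t ≤ ‖deriv g w‖ * (ρ - dist w c) := by gcongr
          _ ≤ _ := h1
          _ = 2 * ‖deriv g z‖ * t := by rw [ht']; ring
      exact le_of_mul_le_mul_right h4 htpos)
  apply homit (g z)
  refine (Metric.ball_subset_ball ?_).trans (key.trans (Set.image_mono ?_))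
  · have : ‖deriv g z‖ * (ρ - dist z c) = 2 * (‖deriv g z‖ * t) := by rw [ht']; ring
    linarith
  · exact (Metric.closedBall_subset_ball (by linarith)).trans (hsub.trans hcU)

/-! ### Lifting through `cosh²` and Schottky's theorem -/

/-- A nonvanishing holomorphic function on a disc has a holomorphic logarithm. -/
lemma exists_differentiableOn_exp_eq {F : ℂ → ℂ} {c : ℂ} {r : ℝ} (hr : 0 < r)
    (hF : DifferentiableOn ℂ F (Metric.ball c r)) (h0 : ∀ z ∈ Metric.ball c r, F z ≠ 0) :
    ∃ L : ℂ → ℂ, DifferentiableOn ℂ L (Metric.ball c r) ∧ L c = Complex.log (F c) ∧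
      ∀ z ∈ Metric.ball c r, Complex.exp (L z) = F z := by
  have hc := Metric.mem_ball_self (x := c) hr
  obtain ⟨L, hLc, hL⟩ := ((hF.deriv Metric.isOpen_ball).div hF h0).isExactOn_ball.with_val_at c
    (Complex.log (F c))
  refine ⟨L, fun z hz => (hL z hz).differentiableAt.differentiableWithinAt, hLc, fun z hz => ?_⟩
  have hd : ∀ w ∈ Metric.ball c r, HasDerivAt (fun w => F w * Complex.exp (-L w)) 0 w := by
    intro w hw
    have h1 := (hF.differentiableAt (Metric.isOpen_ball.mem_nhds hw)).hasDerivAt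
    have h2 : HasDerivAt (fun w => F w * Complex.exp (-L w)) (deriv F w * Complex.exp (-L w) +
        F w * (Complex.exp (-L w) * -(deriv F w / F w))) w := h1.mul (hL w hw).neg.cexp
    have h3 := h0 w hw
    have h4 : deriv F w * Complex.exp (-L w) +
        F w * (Complex.exp (-L w) * -(deriv F w / F w)) = 0 := by field_simp; ring
    rwa [h4] at h2
  have hconst := (convex_ball c r).is_const_of_fderivWithin_eq_zero (𝕜 := ℂ)
    (f := fun w => F w * Complex.exp (-L w))
    (fun w hw => (hd w hw).differentiableAt.differentiableWithinAt)
    (fun w hw => by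
      have := (hd w hw).hasDerivWithinAt (s := Metric.ball c r)
      rw [hasDerivWithinAt_iff_hasFDerivWithinAt] at this
      rw [this.fderivWithin (Metric.isOpen_ball.uniqueDiffWithinAt hw)]
      ext; simp) hz hc
  simp only [hLc, Complex.exp_neg, Complex.exp_log (h0 c hc)] at hconst
  rw [mul_inv_cancel₀ (h0 c hc), mul_inv_eq_one₀ (Complex.exp_ne_zero _)] at hconst
  exact hconst.symm

/-- On `[0, ∞)` a unit step multiplies `cosh` by at least `3 / 2`, so `cosh²` grows by at least `1`
and passes a natural number. -/
lemma exists_cosh_sq_eq_natCast {x : ℝ} (hx : 0 ≤ x) :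
    ∃ u : ℝ, x ≤ u ∧ u ≤ x + 1 ∧ ∃ n : ℕ, Real.cosh u ^ 2 = n := by
  have h1 : Real.cosh x ^ 2 + 1 ≤ Real.cosh (x + 1) ^ 2 := by
    have h2 : 3 / 2 ≤ Real.cosh 1 := by
      have := Real.cosh_eq 1
      have h3 : (5 : ℝ) / 2 ≤ Real.exp 1 := by
        have := Real.exp_one_gt_d9; linarith
      have h4 : (1 : ℝ) / 3 ≤ Real.exp (-1) := by
        rw [Real.exp_neg, one_div]
        apply inv_anti₀ (Real.exp_pos 1)
        have := Real.exp_one_lt_d9; linarith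
      have h5 := Real.exp_one_gt_d9
      linarith
    have h3 : Real.cosh x * (3 / 2) ≤ Real.cosh (x + 1) := by
      rw [Real.cosh_add]
      have h4 : 0 ≤ Real.sinh x := Real.sinh_nonneg_iff.2 hx
      have h5 : 0 ≤ Real.sinh 1 := Real.sinh_nonneg_iff.2 zero_le_one
      have h6 := Real.cosh_pos x
      nlinarith [mul_nonneg h4 h5]
    have h4 := Real.one_le_cosh x
    nlinarith
  obtain ⟨u, hu, hun⟩ := intermediate_value_Icc (by linarith : x ≤ x + 1)
    (f := fun u => Real.cosh u ^ 2) (by fun_prop)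
    (show ((⌈Real.cosh x ^ 2⌉₊ : ℕ) : ℝ) ∈ _ from
      ⟨Nat.le_ceil _, (Nat.ceil_lt_add_one (by positivity)).le.trans h1⟩)
  exact ⟨u, hu.1, hu.2, _, hun⟩

/-- The solutions of `cosh² v ∈ ℕ` form a relatively dense subset of the plane. -/
lemma exists_dist_lt_cosh_sq_eq_natCast (w : ℂ) :
    ∃ v ∈ Metric.ball w 4, ∃ n : ℕ, Complex.cosh v ^ 2 = n := by
  obtain ⟨x, hx, n, hn⟩ : ∃ x : ℝ, |x - w.re| ≤ 1 ∧ ∃ n : ℕ, Real.cosh x ^ 2 = n := by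
    rcases le_total 0 w.re with h | h
    · obtain ⟨u, h1, h2, n, hn⟩ := exists_cosh_sq_eq_natCast h
      exact ⟨u, abs_le.2 ⟨by linarith, by linarith⟩, n, hn⟩
    · obtain ⟨u, h1, h2, n, hn⟩ := exists_cosh_sq_eq_natCast (neg_nonneg.2 h)
      exact ⟨-u, abs_le.2 ⟨by linarith, by linarith⟩, n, by rwa [Real.cosh_neg]⟩
  -- `cosh²` has period `πi`, so the real solution `x` may be shifted to within `π / 2` of the
  -- height of `w`.
  set k : ℤ := round (w.im / Real.pi)
  have hk : |k * Real.pi - w.im| ≤ 2 := by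
    have h1 := abs_sub_round (w.im / Real.pi)
    have h2 : (k * Real.pi - w.im) = -(w.im / Real.pi - k) * Real.pi := by
      field_simp; ring
    rw [h2, abs_mul, abs_neg, abs_of_pos Real.pi_pos]
    have := Real.pi_lt_four
    calc _ ≤ 1 / 2 * Real.pi := by gcongr
      _ ≤ 2 := by linarith
  refine ⟨x + k * Real.pi * Complex.I, ?_, n, ?_⟩
  · rw [mem_ball_iff_norm]
    refine (Complex.norm_le_abs_re_add_abs_im _).trans_lt ?_
    simp only [Complex.sub_re, Complex.add_re, Complex.ofReal_re, Complex.mul_re, Complex.intCast_re,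
      Complex.intCast_im, Complex.ofReal_im, Complex.I_re, Complex.I_im, Complex.sub_im,
      Complex.add_im, Complex.mul_im]
    ring_nf at hx hk ⊢
    linarith
  · have h1 : Complex.sinh (k * Real.pi * Complex.I) = 0 := by
      rw [Complex.sinh_mul_I, Complex.sin_int_mul_pi, zero_mul]
    have h2 := Complex.cosh_sq (k * Real.pi * Complex.I)
    rw [Complex.cosh_add, h1, mul_zero, add_zero, mul_pow, h2, h1]
    rw [← Complex.ofReal_cosh]
    norm_num
    exact_mod_cast hn

/-- A holomorphic function on a disc omitting `0` and `1` is of the form `cosh² g`. -/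
lemma exists_differentiableOn_cosh_sq_eq {l : ℂ → ℂ} {c : ℂ} {r : ℝ} (hr : 0 < r)
    (hl : DifferentiableOn ℂ l (Metric.ball c r)) (h0 : ∀ z ∈ Metric.ball c r, l z ≠ 0)
    (h1 : ∀ z ∈ Metric.ball c r, l z ≠ 1) (hc : ‖l c‖ ≤ 1) :
    ∃ g : ℂ → ℂ, DifferentiableOn ℂ g (Metric.ball c r) ∧ ‖g c‖ ≤ 7 ∧
      ∀ z ∈ Metric.ball c r, Complex.cosh (g z) ^ 2 = l z := by
  obtain ⟨P, hPd, -, hP⟩ := exists_differentiableOn_exp_eq hr hl h0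
  obtain ⟨Q, hQd, -, hQ⟩ := exists_differentiableOn_exp_eq hr (hl.sub_const 1)
    (fun z hz => sub_ne_zero.2 (h1 z hz))
  -- With `p = √l` and `q = √(l - 1)` one has `(p - q) (p + q) = 1`, so `g = log (p - q)` satisfies
  -- `cosh g = p`.
  set p := fun z => Complex.exp (P z / 2) with hp
  set q := fun z => Complex.exp (Q z / 2) with hq
  have hp2 : ∀ z ∈ Metric.ball c r, p z ^ 2 = l z := by
    intro z hz
    rw [← hP z hz, hp, ← Complex.exp_nat_mul]; congr 1; push_cast; ring
  have hq2 : ∀ z ∈ Metric.ball c r, q z ^ 2 = l z - 1 := by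
    intro z hz
    rw [← hQ z hz, hq, ← Complex.exp_nat_mul]; congr 1; push_cast; ring
  have hpq : ∀ z ∈ Metric.ball c r, (p z - q z) * (p z + q z) = 1 := by
    intro z hz
    linear_combination hp2 z hz - hq2 z hz
  have hne : ∀ z ∈ Metric.ball c r, p z - q z ≠ 0 := fun z hz =>
    left_ne_zero_of_mul_eq_one (hpq z hz)
  obtain ⟨g, hgd, hgc, hg⟩ := exists_differentiableOn_exp_eq (F := fun z => p z - q z) hr
    (((hPd.div_const 2).cexp).sub ((hQd.div_const 2).cexp)) hne
  have hcb := Metric.mem_ball_self (x := c) hr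
  refine ⟨g, hgd, ?_, fun z hz => ?_⟩
  · have hpc : ‖p c‖ ≤ 1 := by
      have := congrArg norm (hp2 c hcb)
      rw [norm_pow] at this
      nlinarith [norm_nonneg (p c)]
    have hqc : ‖q c‖ ≤ 2 := by
      have := congrArg norm (hq2 c hcb)
      rw [norm_pow] at this
      have h2 := norm_sub_le (l c) 1
      rw [norm_one] at h2
      nlinarith [norm_nonneg (q c)]
    have hn : 0 < ‖p c - q c‖ := norm_pos_iff.2 (hne c hcb)
    have hmul := congrArg norm (hpq c hcb)
    rw [norm_mul, norm_one] at hmul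
    have hup : ‖p c - q c‖ ≤ 3 := (norm_sub_le _ _).trans (by linarith)
    have hup' : ‖p c + q c‖ ≤ 3 := (norm_add_le _ _).trans (by linarith)
    have hn' : 0 < ‖p c + q c‖ := by
      by_contra! h
      nlinarith
    -- Both `p c - q c` and its inverse `p c + q c` have norm at most `3`, and `log t ≤ t`.
    have hre : |Real.log ‖p c - q c‖| ≤ 3 := by
      rw [abs_le]
      constructor
      · rw [eq_inv_of_mul_eq_one_left hmul, Real.log_inv]
        linarith [Real.log_le_self hn'.le]
      · linarith [Real.log_le_self hn.le]
    rw [hgc]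
    refine (Complex.norm_le_abs_re_add_abs_im _).trans ?_
    rw [Complex.log_re, Complex.log_im]
    have := Complex.abs_arg_le_pi (p c - q c)
    have := Real.pi_lt_four
    linarith
  · have hinv : Complex.exp (-g z) = p z + q z := by
      rw [Complex.exp_neg, hg z hz]
      exact (eq_inv_of_mul_eq_one_right (hpq z hz)).symm
    have : Complex.cosh (g z) = p z := by
      rw [Complex.cosh, hinv, hg z hz]; ring
    rw [this, hp2 z hz]

/-- A form of **Schottky's theorem**: holomorphic functions on a disc omitting `0` and `1` and taking
at the centre a value near `2` are uniformly bounded on a smaller disc. -/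
lemma exists_norm_le_of_omits_zero_one : ∃ C : ℝ, ∀ (F : ℂ → ℂ) (c : ℂ),
    DifferentiableOn ℂ F (Metric.ball c 16) → (∀ z ∈ Metric.ball c 16, F z ≠ 0) →
    (∀ z ∈ Metric.ball c 16, F z ≠ 1) → ‖F c - 2‖ < 1 →
    ∀ z ∈ Metric.ball c 4, ‖F z‖ ≤ C := by
  -- `103 = 7 + 24 * 4`: the bound on `g c`, plus the bound on `deriv g` times the radius.
  refine ⟨Real.exp (2 * Real.pi * Real.exp 103 ^ 2), fun F c hF h0 h1 hc z hz => ?_⟩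
  have hcb := Metric.mem_ball_self (x := c) (show (0 : ℝ) < 16 by norm_num)
  obtain ⟨L, hLd, hLc, hL⟩ := exists_differentiableOn_exp_eq (by norm_num) hF h0
  have hpi : (2 * Real.pi * Complex.I : ℂ) ≠ 0 := Complex.two_pi_I_ne_zero
  have hln : ∀ w ∈ Metric.ball c 16, ∀ n : ℤ, L w / (2 * Real.pi * Complex.I) ≠ n := by
    intro w hw n h
    rw [div_eq_iff hpi] at h
    apply h1 w hw
    rw [← hL w hw, h, Complex.exp_int_mul_two_pi_mul_I]
  obtain ⟨g, hgd, hgc, hg⟩ := exists_differentiableOn_cosh_sq_eq (c := c) (r := 16)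
    (l := fun w => L w / (2 * Real.pi * Complex.I)) (by norm_num)
    (hLd.div_const _) (fun w hw => by simpa using hln w hw 0) (fun w hw => by simpa using hln w hw 1)
    (by
      have h2 : ‖(2 * Real.pi * Complex.I : ℂ)‖ = 2 * Real.pi := by
        simp [abs_of_pos Real.pi_pos]
      rw [norm_div, h2, div_le_one (by positivity), hLc]
      refine (Complex.norm_le_abs_re_add_abs_im _).trans ?_
      rw [Complex.log_re, Complex.log_im]
      have h3 := Complex.abs_arg_le_pi (F c)
      have h4 : 1 ≤ ‖F c‖ := by
        have := norm_sub_norm_le 2 (F c)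
        rw [norm_sub_rev 2, Complex.norm_ofNat] at this
        linarith
      have h5 : ‖F c‖ ≤ 3 := by
        have := norm_sub_norm_le (F c) 2
        rw [Complex.norm_ofNat] at this
        linarith
      rw [abs_of_nonneg (Real.log_nonneg h4)]
      have h6 := Real.log_le_sub_one_of_pos (show 0 < ‖F c‖ by linarith)
      linarith [Real.pi_gt_three])
  -- `F ≠ 1` keeps `cosh² g = L / 2πi` off all integers, while every disc of radius `4` contains a
  -- point with `cosh²` in `ℕ`.
  have homit : ∀ w, ¬ Metric.ball w 4 ⊆ g '' Metric.ball c 16 := by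
    intro w hw
    obtain ⟨v, hv, n, hn⟩ := exists_dist_lt_cosh_sq_eq_natCast w
    obtain ⟨u, hu, rfl⟩ := hw hv
    rw [hg u hu] at hn
    exact hln u hu n (by simpa using hn)
  have hderiv : ∀ w ∈ Metric.ball c 4, ‖deriv g w‖ ≤ 24 := by
    intro w hw
    have := norm_deriv_mul_le_of_not_ball_subset (c := w) (ρ := 8) (D := 4) Metric.isOpen_ball
      (by norm_num) (by norm_num)
      ((Metric.closedBall_subset_closedBall' (by rw [Metric.mem_ball] at hw; linarith)).trans
        (Metric.closedBall_subset_ball (show (12 : ℝ) < 16 by norm_num))) hgd homit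
    linarith
  have hgz : ‖g z‖ ≤ 103 := by
    have h := (convex_ball c 4).norm_image_sub_le_of_norm_deriv_le (f := g) (C := 24)
      (fun w hw => hgd.differentiableAt (Metric.isOpen_ball.mem_nhds
        (Metric.ball_subset_ball (by norm_num) hw))) hderiv
      (Metric.mem_ball_self (by norm_num)) hz
    have h2 : ‖z - c‖ < 4 := mem_ball_iff_norm.1 hz
    have h3 := norm_sub_norm_le (g z) (g c)
    linarith
  have hz16 : z ∈ Metric.ball c 16 := Metric.ball_subset_ball (by norm_num) hz
  have hcosh : ‖Complex.cosh (g z)‖ ≤ Real.exp 103 := by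
    rw [Complex.cosh, norm_div, Complex.norm_ofNat]
    have h2 : ∀ v : ℂ, ‖v‖ ≤ 103 → ‖Complex.exp v‖ ≤ Real.exp 103 := by
      intro v hv
      rw [Complex.norm_exp]
      exact Real.exp_le_exp.2 ((Complex.re_le_norm v).trans hv)
    have h3 := norm_add_le (Complex.exp (g z)) (Complex.exp (-g z))
    have h4 := h2 _ hgz
    have h5 := h2 (-g z) (by rwa [norm_neg])
    linarith
  have hLz : L z = 2 * Real.pi * Complex.I * Complex.cosh (g z) ^ 2 := by
    rw [hg z hz16]; field_simp
  rw [← hL z hz16, Complex.norm_exp]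
  apply Real.exp_le_exp.2
  refine (Complex.re_le_norm _).trans ?_
  rw [hLz, norm_mul, norm_pow]
  have h2 : ‖(2 * Real.pi * Complex.I : ℂ)‖ = 2 * Real.pi := by
    simp [abs_of_pos Real.pi_pos]
  rw [h2]
  gcongr

/-! ### Casorati–Weierstrass and Picard -/

/-- **Casorati–Weierstrass**: an entire function with an essential singularity at infinity comes
close to every value at points of arbitrarily large modulus. -/
lemma exists_norm_sub_lt_of_essential {f : ℂ → ℂ} (hf : Differentiable ℂ f)
    (hess : HasEssentialSingularityAtInfinity f) (b : ℂ) {ε : ℝ} (hε : 0 < ε) (R : ℝ) :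
    ∃ z, R < ‖z‖ ∧ ‖f z - b‖ < ε := by
  by_contra! hfar
  apply hess.2
  -- `G` is bounded near `0`, so its singularity is removable and `f w⁻¹ = (G w)⁻¹ + b` is
  -- meromorphic there.
  set G : ℂ → ℂ := fun w => (f w⁻¹ - b)⁻¹ with hG
  set r : ℝ := (max R 1)⁻¹ with hr
  have hrpos : 0 < r := by positivity
  have hlarge : ∀ w ∈ Metric.ball (0 : ℂ) r \ {0}, ε ≤ ‖f w⁻¹ - b‖ := by
    intro w hw
    apply hfar
    rw [norm_inv]
    have h1 : ‖w‖ < (max R 1)⁻¹ := by simpa using hw.1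
    have h2 : 0 < ‖w‖ := norm_pos_iff.2 hw.2
    exact (le_max_left R 1).trans_lt ((lt_inv_comm₀ h2 (by positivity)).1 h1)
  have hGd : DifferentiableOn ℂ G (Metric.ball (0 : ℂ) r \ {0}) := by
    intro w hw
    have h1 : w ≠ 0 := hw.2
    have h2 : f w⁻¹ - b ≠ 0 := norm_pos_iff.1 (hε.trans_le (hlarge w hw))
    have h3 : DifferentiableAt ℂ (fun w => f w⁻¹ - b) w :=
      ((hf w⁻¹).comp w (differentiableAt_inv h1)).sub_const b
    exact (h3.inv h2).differentiableWithinAt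
  have hGb : BddAbove (norm ∘ G '' (Metric.ball (0 : ℂ) r \ {0})) := by
    refine ⟨ε⁻¹, ?_⟩
    rintro _ ⟨w, hw, rfl⟩
    simp only [Function.comp, hG, norm_inv]
    exact inv_anti₀ hε (hlarge w hw)
  have hrem := Complex.differentiableOn_update_limUnder_of_bddAbove
    (Metric.ball_mem_nhds (0 : ℂ) hrpos) hGd hGb
  have hmer : MeromorphicAt G 0 :=
    MeromorphicAt.update_iff.1
      (hrem.analyticAt (Metric.ball_mem_nhds (0 : ℂ) hrpos)).meromorphicAt
  have := hmer.inv.add (MeromorphicAt.const b 0)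
  exact this.congr (Eventually.of_forall fun w => by simp [hG])

/-- Liouville: a bounded entire function is constant. -/
lemma not_isBounded_range_of_essential {f : ℂ → ℂ} (hf : Differentiable ℂ f)
    (hess : HasEssentialSingularityAtInfinity f) : ¬ Bornology.IsBounded (Set.range f) := by
  intro hb
  apply hess.2
  have : (fun w : ℂ => f w⁻¹) = fun _ => f 0 := by
    ext w
    exact hf.apply_eq_apply_of_bounded hb _ _
  rw [this]
  exact MeromorphicAt.const _ _

/-- An entire function with an essential singularity at infinity takes one of the values `0` and `1`
at points of arbitrarily large modulus. -/
lemma exists_eq_zero_or_eq_one_of_essential {f : ℂ → ℂ} (hf : Differentiable ℂ f)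
    (hess : HasEssentialSingularityAtInfinity f) (R : ℝ) :
    ∃ z, R < ‖z‖ ∧ (f z = 0 ∨ f z = 1) := by
  by_contra! hom
  obtain ⟨C, hC⟩ := exists_norm_le_of_omits_zero_one
  refine not_isBounded_range_of_essential hf hess ?_
  refine (Metric.isBounded_iff_subset_closedBall 0).2 ⟨C, ?_⟩
  rintro _ ⟨x, rfl⟩
  rw [mem_closedBall_zero_iff]
  -- The threshold puts `x` inside the circle through `z`, and its factor `exp 16` keeps `exp` of
  -- the disc of radius `16` about `log z` beyond `R`.
  obtain ⟨z, hz, hfz⟩ := exists_norm_sub_lt_of_essential hf hess 2 one_pos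
    (max ‖x‖ (max R 1 * Real.exp 16))
  have hzx := (le_max_left _ _).trans_lt hz
  have hzR := (le_max_right _ _).trans_lt hz
  have hz0 : z ≠ 0 := by
    rintro rfl
    rw [norm_zero] at hzx
    exact absurd hzx (not_lt.2 (norm_nonneg x))
  have hom' : ∀ w ∈ Metric.ball (Complex.log z) 16, R < ‖Complex.exp w‖ := by
    intro w hw
    rw [mem_ball_iff_norm] at hw
    have h1 : (Complex.log z).re - 16 ≤ w.re := by
      have := (Complex.abs_re_le_norm (w - Complex.log z))
      rw [Complex.sub_re] at this
      linarith [(abs_le.1 (this.trans hw.le)).1]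
    rw [Complex.norm_exp]
    have h2 := Real.exp_le_exp.2 h1
    rw [Real.exp_sub, Complex.log_re, Real.exp_log (norm_pos_iff.2 hz0)] at h2
    refine (le_max_left R 1).trans_lt (lt_of_lt_of_le ?_ h2)
    rwa [lt_div_iff₀ (Real.exp_pos _)]
  -- Every point of the circle is the exponential of a point within `π < 4` of `log z`, so
  -- Schottky's bound for `f ∘ exp` covers the whole circle.
  have hcirc : ∀ u : ℂ, ‖u‖ = ‖z‖ → ‖f u‖ ≤ C := by
    intro u hu
    have hu0 : u ≠ 0 := norm_ne_zero_iff.1 (hu ▸ norm_ne_zero_iff.2 hz0)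
    have hq : u / z ≠ 0 := div_ne_zero hu0 hz0
    have h := hC (fun w => f (Complex.exp w)) (Complex.log z)
      (hf.comp Complex.differentiable_exp).differentiableOn
      (fun w hw => (hom _ (hom' w hw)).1) (fun w hw => (hom _ (hom' w hw)).2)
      (by simpa only [Complex.exp_log hz0] using hfz) (Complex.log z + Complex.log (u / z)) (by
        rw [mem_ball_iff_norm, add_sub_cancel_left]
        refine (Complex.norm_le_abs_re_add_abs_im _).trans_lt ?_
        rw [Complex.log_re, Complex.log_im, norm_div, hu, div_self (norm_ne_zero_iff.2 hz0),
          Real.log_one, abs_zero, zero_add]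
        exact (Complex.abs_arg_le_pi _).trans_lt Real.pi_lt_four)
    simpa only [Complex.exp_add, Complex.exp_log hz0, Complex.exp_log hq, mul_div_cancel₀ _ hz0]
      using h
  have hzpos := norm_pos_iff.2 hz0
  refine Complex.norm_le_of_forall_mem_frontier_norm_le (U := Metric.ball 0 ‖z‖)
    Metric.isBounded_ball hf.diffContOnCl (fun u hu => hcirc u ?_)
    (subset_closure (by simpa using hzx))
  rw [frontier_ball _ hzpos.ne'] at hu
  simpa using hu

/-- The **great Picard theorem** for entire functions. -/
theorem exists_eq_or_eq_of_essential {f : ℂ → ℂ} (hf : Differentiable ℂ f)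
    (hess : HasEssentialSingularityAtInfinity f) {a b : ℂ} (hab : a ≠ b) (R : ℝ) :
    ∃ z, R < ‖z‖ ∧ (f z = a ∨ f z = b) := by
  have hba : b - a ≠ 0 := sub_ne_zero.2 hab.symm
  have hess' : HasEssentialSingularityAtInfinity fun z => (f z - a) / (b - a) := by
    refine ⟨?_, fun hmer => hess.2 ?_⟩
    · filter_upwards [hess.1] with w hw
      exact (hw.sub analyticAt_const).div_const
    · have := (hmer.mul (MeromorphicAt.const (b - a) 0)).add (MeromorphicAt.const a 0)
      exact this.congr (Eventually.of_forall fun w => by simp [hba])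
  obtain ⟨z, hz, h⟩ := exists_eq_zero_or_eq_one_of_essential
    ((hf.sub_const a).div_const (b - a)) hess' R
  refine ⟨z, hz, h.imp (fun h => ?_) fun h => ?_⟩
  · simpa [hba, sub_eq_zero] using h
  · rw [div_eq_one_iff_eq hba] at h
    exact sub_left_injective h

/-- All values with at most one exception are taken at points of arbitrarily large modulus. -/
theorem exists_forall_ne_exists_eq_of_essential {f : ℂ → ℂ} (hf : Differentiable ℂ f)
    (hess : HasEssentialSingularityAtInfinity f) :
    ∃ a, ∀ b ≠ a, ∀ R : ℝ, ∃ z, R < ‖z‖ ∧ f z = b := by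
  by_cases h : ∀ b, ∀ R : ℝ, ∃ z, R < ‖z‖ ∧ f z = b
  · exact ⟨0, fun b _ => h b⟩
  · push Not at h
    obtain ⟨a, R₀, ha⟩ := h
    refine ⟨a, fun b hb R => ?_⟩
    obtain ⟨z, hz, h1⟩ := exists_eq_or_eq_of_essential hf hess hb (max R R₀)
    have h2 := ha z ((le_max_right _ _).trans_lt hz)
    exact ⟨z, (le_max_left _ _).trans_lt hz, h1.resolve_right h2⟩
/-! ### Nagata dimension of subsets -/

/-- `S` is covered by sets of diameter at most `r` such that every subset of `S` of diameter at
most `s` meets at most `m` of them. -/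
def HasCovering {E : Type*} [MetricSpace E] (S : Set E) (s r : ℝ) (m : ℕ) : Prop :=
  ∃ 𝓑 : Set (Set E), S ⊆ ⋃₀ 𝓑 ∧ (∀ B ∈ 𝓑, ∀ x ∈ B, ∀ y ∈ B, dist x y ≤ r) ∧
    ∀ A ⊆ S, (∀ x ∈ A, ∀ y ∈ A, dist x y ≤ s) → {B ∈ 𝓑 | (B ∩ A).Nonempty}.encard ≤ m

section Nagata

variable {E : Type*} [MetricSpace E] {S T : Set E} {s r r' : ℝ} {m : ℕ}

lemma ediam_le_ofReal_iff {A : Set E} (hr : 0 ≤ r) :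
    Metric.ediam A ≤ ENNReal.ofReal r ↔ ∀ x ∈ A, ∀ y ∈ A, dist x y ≤ r := by
  simp only [Metric.ediam_le_iff, edist_le_ofReal hr]

lemma HasCovering.mono_set (h : HasCovering T s r m) (hST : S ⊆ T) : HasCovering S s r m := by
  obtain ⟨𝓑, h1, h2, h3⟩ := h
  exact ⟨𝓑, hST.trans h1, h2, fun A hA => h3 A (hA.trans hST)⟩

lemma HasCovering.mono_diam (h : HasCovering S s r m) (hr : r ≤ r') : HasCovering S s r' m := by
  obtain ⟨𝓑, h1, h2, h3⟩ := h
  exact ⟨𝓑, h1, fun B hB x hx y hy => (h2 B hB x hx y hy).trans hr, h3⟩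

lemma HasCovering.one_le (h : HasCovering S s r m) (hS : S.Nonempty) (hs : 0 ≤ s) : 1 ≤ m := by
  obtain ⟨𝓑, h1, -, h3⟩ := h
  obtain ⟨x, hx⟩ := hS
  obtain ⟨B, hB, hxB⟩ := h1 hx
  have h := h3 {x} (by simpa using hx) (by simpa using hs)
  have h4 : (1 : ℕ∞) ≤ {B ∈ 𝓑 | (B ∩ {x}).Nonempty}.encard :=
    Set.one_le_encard_iff_nonempty.2 ⟨B, hB, x, hxB, rfl⟩
  exact_mod_cast h4.trans h

/-- Moves coverings from the subtype to the ambient space, where those of different sets can be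
compared. The multiplicity need only be bounded, so `m` can be taken equal to `n + 1`. -/
lemma hasNagataCoverings_iff (S : Set E) (n : ℤ) :
    HasNagataCoverings S n ↔
      ∃ m : ℕ, (m : ℤ) = n + 1 ∧ ∃ c : ℝ, 0 < c ∧ ∀ s : ℝ, 0 < s → HasCovering S s (c * s) m := by
  constructor
  · rintro ⟨c, hc, h⟩
    have hn : 0 ≤ n + 1 := by
      obtain ⟨-, -, -, m, -, hm⟩ := h 1 one_pos
      omega
    refine ⟨(n + 1).toNat, Int.toNat_of_nonneg hn, c, hc, fun s hs => ?_⟩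
    obtain ⟨𝓑, hcov, hbd, m, hm, hmn⟩ := h s hs
    refine ⟨(fun B => Subtype.val '' B) '' 𝓑, ?_, ?_, ?_⟩
    · intro x hx
      obtain ⟨B, hB, hxB⟩ : (⟨x, hx⟩ : S) ∈ ⋃₀ 𝓑 := hcov ▸ Set.mem_univ _
      exact ⟨_, ⟨B, hB, rfl⟩, ⟨x, hx⟩, hxB, rfl⟩
    · rintro _ ⟨B, hB, rfl⟩ _ ⟨x, hx, rfl⟩ _ ⟨y, hy, rfl⟩
      exact (ediam_le_ofReal_iff (by positivity)).1 (hbd B hB) x hx y hy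
    · intro A _ hdiam
      have hA := (le_sInf fun k hk => hk (Subtype.val ⁻¹' A)
        ((ediam_le_ofReal_iff hs.le).2 fun x hx y hy => hdiam x hx y hy) :
        {B ∈ 𝓑 | (B ∩ Subtype.val ⁻¹' A).Nonempty}.encard ≤ familyMultiplicity s 𝓑)
      calc _ ≤ ((fun B => Subtype.val '' B) ''
            {B ∈ 𝓑 | (B ∩ Subtype.val ⁻¹' A).Nonempty}).encard := by
            apply Set.encard_le_encard
            rintro _ ⟨⟨B, hB, rfl⟩, _, ⟨x, hx, rfl⟩, hxA⟩
            exact ⟨B, ⟨hB, x, hx, hxA⟩, rfl⟩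
        _ ≤ _ := Set.encard_image_le _ _
        _ ≤ m := hm ▸ hA
        _ ≤ _ := by exact_mod_cast (by omega : m ≤ (n + 1).toNat)
  · rintro ⟨m, hmn, c, hc, h⟩
    refine ⟨c, hc, fun s hs => ?_⟩
    obtain ⟨𝓑, hcov, hbd, hmul⟩ := h s hs
    refine ⟨(fun B => Subtype.val ⁻¹' B) '' 𝓑, ?_, ?_, ?_⟩
    · refine Set.eq_univ_of_forall fun x => ?_
      obtain ⟨B, hB, hxB⟩ := hcov x.2
      exact ⟨_, ⟨B, hB, rfl⟩, hxB⟩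
    · rintro _ ⟨B, hB, rfl⟩
      exact (ediam_le_ofReal_iff (by positivity)).2 fun x hx y hy => hbd B hB x hx y hy
    · have hle : familyMultiplicity s ((fun B => (Subtype.val ⁻¹' B : Set S)) '' 𝓑) ≤ m := by
        refine sInf_le fun A hA => ?_
        rw [ediam_le_ofReal_iff hs.le] at hA
        calc _ ≤ ((fun B => (Subtype.val ⁻¹' B : Set S)) ''
              {B ∈ 𝓑 | (B ∩ Subtype.val '' A).Nonempty}).encard := by
              apply Set.encard_le_encard
              rintro _ ⟨⟨B, hB, rfl⟩, x, hx, hxA⟩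
              exact ⟨B, ⟨hB, x, hx, x, hxA, rfl⟩, rfl⟩
          _ ≤ _ := Set.encard_image_le _ _
          _ ≤ m := hmul _ (Subtype.coe_image_subset S A) (by
              rintro _ ⟨x, hx, rfl⟩ _ ⟨y, hy, rfl⟩
              exact hA x hx y hy)
      obtain ⟨k, hk⟩ := ENat.ne_top_iff_exists.1 (ne_top_of_le_ne_top (ENat.natCast_ne_top m) hle)
      refine ⟨k, hk.symm, ?_⟩
      rw [← hk] at hle
      have : k ≤ m := by exact_mod_cast hle
      omega

/-! ### Constructions of coverings -/

/-- A covering of `S` induces one of any set in the `s`-neighbourhood of `S`. -/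
lemma HasCovering.of_forall_exists_dist_le (h : HasCovering S (3 * s) r m)
    (hT : ∀ z ∈ T, ∃ y ∈ S, dist z y ≤ s) : HasCovering T s (r + 2 * s) m := by
  obtain ⟨𝓑, h1, h2, h3⟩ := h
  refine ⟨(fun B => {z | ∃ b ∈ B ∩ S, dist z b ≤ s}) '' 𝓑, ?_, ?_, ?_⟩
  · intro z hz
    obtain ⟨y, hy, hzy⟩ := hT z hz
    obtain ⟨B, hB, hyB⟩ := h1 hy
    exact ⟨_, ⟨B, hB, rfl⟩, y, ⟨hyB, hy⟩, hzy⟩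
  · rintro _ ⟨B, hB, rfl⟩ x ⟨b, hb, hxb⟩ y ⟨b', hb', hyb'⟩
    have h4 := h2 B hB b hb.1 b' hb'.1
    have h5 := dist_triangle4 x b b' y
    rw [dist_comm b' y] at h5
    linarith
  · intro A _ hA
    -- Points of `S` within `s` of `A` are at most `3 * s` apart, hence the scale in `h`.
    set A' := {y ∈ S | ∃ a ∈ A, dist a y ≤ s}
    calc _ ≤ ((fun B => {z | ∃ b ∈ B ∩ S, dist z b ≤ s}) ''
          {B ∈ 𝓑 | (B ∩ A').Nonempty}).encard := by
          apply Set.encard_le_encard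
          rintro _ ⟨⟨B, hB, rfl⟩, x, ⟨b, hb, hxb⟩, hxA⟩
          exact ⟨B, ⟨hB, b, hb.1, hb.2, x, hxA, hxb⟩, rfl⟩
      _ ≤ _ := Set.encard_image_le _ _
      _ ≤ m := h3 A' (Set.sep_subset _ _) (by
          rintro x ⟨-, a, ha, hax⟩ y ⟨-, a', ha', hay⟩
          have h4 := hA a ha a' ha'
          have h5 := dist_triangle4 x a a' y
          rw [dist_comm x a] at h5
          linarith)

/-- A set of diameter at most `s` cannot meet both `S` and `T`, so multiplicities do not add.
Members are cut down to `S` or `T` lest they reach into the other set. -/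
lemma HasCovering.union (hs : 0 ≤ s) (hS : HasCovering S s r m) (hT : HasCovering T s r m)
    (hsep : ∀ x ∈ S, ∀ y ∈ T, s < dist x y) : HasCovering (S ∪ T) s r m := by
  obtain ⟨𝓑, h1, h2, h3⟩ := hS
  obtain ⟨𝓒, h1', h2', h3'⟩ := hT
  have hdisj : ∀ x ∈ S, x ∉ T := fun x hx hx' => by
    have := hsep x hx x hx'
    rw [dist_self] at this
    exact this.not_ge hs
  refine ⟨(fun B => B ∩ S) '' 𝓑 ∪ (fun B => B ∩ T) '' 𝓒, ?_, ?_, ?_⟩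
  · rintro x (hx | hx)
    · obtain ⟨B, hB, hxB⟩ := h1 hx
      exact ⟨_, Or.inl ⟨B, hB, rfl⟩, hxB, hx⟩
    · obtain ⟨B, hB, hxB⟩ := h1' hx
      exact ⟨_, Or.inr ⟨B, hB, rfl⟩, hxB, hx⟩
  · rintro _ (⟨B, hB, rfl⟩ | ⟨B, hB, rfl⟩) x hx y hy
    · exact h2 B hB x hx.1 y hy.1
    · exact h2' B hB x hx.1 y hy.1
  · intro A hA hdiam
    have hcase : A ⊆ S ∨ A ⊆ T := by
      by_contra! h
      obtain ⟨⟨x, hx, hxS⟩, ⟨y, hy, hyT⟩⟩ := h.imp Set.not_subset.1 Set.not_subset.1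
      have hxT := (hA hx).resolve_left hxS
      have hyS := (hA hy).resolve_right hyT
      exact (hsep y hyS x hxT).not_ge (hdiam y hy x hx)
    rcases hcase with hAS | hAT
    · calc _ ≤ ((fun B => B ∩ S) '' {B ∈ 𝓑 | (B ∩ A).Nonempty}).encard := by
            apply Set.encard_le_encard
            rintro _ ⟨⟨B, hB, rfl⟩ | ⟨B, hB, rfl⟩, x, hx, hxA⟩
            · exact ⟨B, ⟨hB, x, hx.1, hxA⟩, rfl⟩
            · exact absurd hx.2 (hdisj x (hAS hxA))
        _ ≤ _ := Set.encard_image_le _ _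
        _ ≤ m := h3 A hAS hdiam
    · calc _ ≤ ((fun B => B ∩ T) '' {B ∈ 𝓒 | (B ∩ A).Nonempty}).encard := by
            apply Set.encard_le_encard
            rintro _ ⟨⟨B, hB, rfl⟩ | ⟨B, hB, rfl⟩, x, hx, hxA⟩
            · exact absurd (hAT hxA) (hdisj x hx.2)
            · exact ⟨B, ⟨hB, x, hx.1, hxA⟩, rfl⟩
        _ ≤ _ := Set.encard_image_le _ _
        _ ≤ m := h3' A hAT hdiam

/-- Sets whose points have geometrically growing distances from a given point have coverings of
multiplicity one at all scales. -/
lemma hasCovering_of_geometric {a : E} (hs : 0 < s)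
    (hS : ∀ x ∈ S, ∀ y ∈ S, x ≠ y → 2 * dist x a ≤ dist y a ∨ 2 * dist y a ≤ dist x a)
    (hm : 1 ≤ m) : HasCovering S s (4 * s) m := by
  -- A point farther than `2 * s` from `a` is more than `s` away from every other point of `S`. One
  -- ball and singletons therefore suffice.
  have hiso : ∀ x ∈ S, ∀ y ∈ S, dist x y ≤ s → 2 * s < dist x a → x = y := by
    intro x hx y hy hxy hxa
    by_contra hne
    have h1 := dist_triangle x y a
    have h2 := dist_triangle_left y a x
    rcases hS x hx y hy hne with h | h <;> linarith
  refine ⟨insert (Metric.closedBall a (2 * s)) {B | ∃ x ∈ S, 2 * s < dist x a ∧ B = {x}},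
    ?_, ?_, ?_⟩
  · intro x hx
    rcases le_or_gt (dist x a) (2 * s) with h | h
    · exact ⟨_, Or.inl rfl, h⟩
    · exact ⟨_, Or.inr ⟨x, hx, h, rfl⟩, rfl⟩
  · rintro B (rfl | ⟨z, -, -, rfl⟩) x hx y hy
    · have := dist_triangle_right x y a
      rw [Metric.mem_closedBall] at hx hy
      linarith
    · rw [Set.mem_singleton_iff.1 hx, Set.mem_singleton_iff.1 hy, dist_self]
      positivity
  · intro A hAS hA
    refine le_trans (Set.encard_le_one_iff.2 ?_) (by exact_mod_cast hm : (1 : ℕ∞) ≤ m)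
    rintro B B' ⟨hB, x, hxB, hxA⟩ ⟨hB', y, hyB, hyA⟩
    have hxy := hA x hxA y hyA
    have hx := hAS hxA
    have hy := hAS hyA
    rcases hB with rfl | ⟨u, -, hua, rfl⟩ <;> rcases hB' with rfl | ⟨v, -, hva, rfl⟩
    · rfl
    · obtain rfl := Set.mem_singleton_iff.1 hyB
      obtain rfl := hiso y hy x hx (by rwa [dist_comm]) hva
      exact absurd (Metric.mem_closedBall.1 hxB) hva.not_ge
    · obtain rfl := Set.mem_singleton_iff.1 hxB
      obtain rfl := hiso x hx y hy hxy hua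
      exact absurd (Metric.mem_closedBall.1 hyB) hua.not_ge
    · obtain rfl := Set.mem_singleton_iff.1 hxB
      obtain rfl := Set.mem_singleton_iff.1 hyB
      rw [hiso x hx y hy hxy hua]

lemma HasNagataCoverings.mono {n : ℤ} (hST : S ⊆ T) (h : HasNagataCoverings T n) :
    HasNagataCoverings S n := by
  rw [hasNagataCoverings_iff] at h ⊢
  obtain ⟨m, hm, c, hc, h⟩ := h
  exact ⟨m, hm, c, hc, fun s hs => (h s hs).mono_set hST⟩

/-- Each point of `T` is within `s` of `S`, so a covering of `S` at scale `3 * s` can be thickened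
by `s`; this costs `c ↦ 3 * c + 2`. -/
lemma HasNagataCoverings.of_subset_closure {n : ℤ} (hST : T ⊆ closure S)
    (h : HasNagataCoverings S n) : HasNagataCoverings T n := by
  rw [hasNagataCoverings_iff] at h ⊢
  obtain ⟨m, hm, c, hc, h⟩ := h
  refine ⟨m, hm, 3 * c + 2, by positivity, fun s hs => ?_⟩
  refine ((h (3 * s) (by positivity)).of_forall_exists_dist_le fun z hz => ?_).mono_diam
    (by linarith)
  obtain ⟨y, hy, hzy⟩ := Metric.mem_closure_iff.1 (hST hz) s hs
  exact ⟨y, hy, hzy.le⟩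

/-- Replacing an isolated point by a sequence converging geometrically to it preserves the existence
of Nagata coverings. -/
lemma HasNagataCoverings.replace_isolated {n : ℤ} {a : E} {δ : ℝ} {G : Set E}
    (h : HasNagataCoverings S n) (ha : a ∈ S) 
    (hiso : ∀ y ∈ S, y ≠ a → 2 * δ < dist y a) (hGa : ∀ g ∈ G, dist g a ≤ δ)
    (hG : ∀ x ∈ G, ∀ y ∈ G, x ≠ y → 2 * dist x a ≤ dist y a ∨ 2 * dist y a ≤ dist x a) :
    HasNagataCoverings (S \ {a} ∪ G : Set E) n := by
  rw [hasNagataCoverings_iff] at h ⊢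
  obtain ⟨m, hm, c, hc, h⟩ := h
  refine ⟨m, hm, 3 * c + 4, by positivity, fun s hs => ?_⟩
  -- Below `δ` the sets `S \ {a}` and `G` are more than `s` apart and are covered separately; from
  -- `δ` on, `G` lies in the `s`-neighbourhood of `a`.
  rcases lt_or_ge s δ with hsδ | hsδ
  · refine HasCovering.union hs.le
      (((h s hs).mono_set Set.sdiff_subset).mono_diam (by nlinarith [mul_pos hc hs]))
      ((hasCovering_of_geometric hs hG ((h s hs).one_le ⟨a, ha⟩ hs.le)).mono_diam
        (by nlinarith [mul_pos hc hs])) ?_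
    intro x hx y hy
    have h1 := hiso x hx.1 hx.2
    have h2 := hGa y hy
    have h3 := dist_triangle x y a
    linarith
  · refine ((h (3 * s) (by positivity)).of_forall_exists_dist_le ?_).mono_diam (by linarith)
    rintro z (hz | hz)
    · exact ⟨z, hz.1, by rw [dist_self]; exact hs.le⟩
    · exact ⟨a, ha, (hGa z hz).trans hsδ⟩

lemma nagataDim_congr (h : ∀ n, HasNagataCoverings S n ↔ HasNagataCoverings T n) :
    nagataDim S = nagataDim T :=
  iInf_congr fun n => iInf_congr_Prop (h n) fun _ => rfl

lemma nagataDim_eq_zero_of_geometric {a : E} (hne : S.Nonempty)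
    (hS : ∀ x ∈ S, ∀ y ∈ S, x ≠ y → 2 * dist x a ≤ dist y a ∨ 2 * dist y a ≤ dist x a) :
    nagataDim S = 0 := by
  apply le_antisymm
  · have h : HasNagataCoverings S 0 := (hasNagataCoverings_iff S 0).2
      ⟨1, rfl, 4, by norm_num, fun s hs => hasCovering_of_geometric hs hS le_rfl⟩
    refine (iInf₂_le 0 h).trans ?_
    simp
  -- Nonemptiness rules out multiplicity zero, hence `n = -1`.
  · refine le_iInf₂ fun n hn => ?_
    obtain ⟨m, hm, c, hc, h⟩ := (hasNagataCoverings_iff S n).1 hn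
    have h1 := (h 1 one_pos).one_le hne zero_le_one
    have h2 : (0 : ℝ) ≤ n := by exact_mod_cast (by omega : (0 : ℤ) ≤ n)
    exact_mod_cast h2

end Nagata
/-! ### The main theorem -/

/-- Preimages of countably many values, each taken at points of arbitrarily large modulus, can be
chosen with geometrically growing moduli. -/
lemma exists_geometric_image_eq {f : ℂ → ℂ} {D : Set ℂ} (hD : D.Countable)
    (hf : ∀ d ∈ D, ∀ R : ℝ, ∃ z, R < ‖z‖ ∧ f z = d) (R : ℝ) :
    ∃ X : Set ℂ, X.Countable ∧ f '' X = D ∧ (∀ x ∈ X, R < ‖x‖) ∧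
      ∀ x ∈ X, ∀ y ∈ X, x ≠ y → 2 * ‖x‖ ≤ ‖y‖ ∨ 2 * ‖y‖ ≤ ‖x‖ := by
  rcases D.eq_empty_or_nonempty with rfl | hne
  · exact ⟨∅, by simp⟩
  obtain ⟨u, rfl⟩ := hD.exists_eq_range hne
  choose p hp hpu using fun n => hf (u n) ⟨n, rfl⟩
  -- The values `u n` may repeat; each repetition receives a new preimage, which does no harm.
  set x : ℕ → ℂ := fun n => Nat.rec (p 0 R) (fun k z => p (k + 1) (max R (2 * ‖z‖))) n with hx
  have hsucc : ∀ n, x (n + 1) = p (n + 1) (max R (2 * ‖x n‖)) := fun n => rfl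
  have hstep : ∀ n, 2 * ‖x n‖ < ‖x (n + 1)‖ := fun n => by
    rw [hsucc]; exact (le_max_right _ _).trans_lt (hp _ _)
  have hmono : Monotone fun n => ‖x n‖ := monotone_nat_of_le_succ fun n => by
    linarith [hstep n, norm_nonneg (x n)]
  have hlt : ∀ m n, m < n → 2 * ‖x m‖ ≤ ‖x n‖ := fun m n hmn =>
    (hstep m).le.trans (hmono hmn)
  have hfx : ∀ n, f (x n) = u n := by
    rintro (_ | n)
    · exact hpu 0 R
    · rw [hsucc]; exact hpu _ _
  refine ⟨Set.range x, Set.countable_range x, ?_, ?_, ?_⟩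
  · rw [← Set.range_comp]
    congr 1
    ext n
    exact hfx n
  · rintro _ ⟨n, rfl⟩
    rcases n with _ | n
    · exact hp 0 R
    · rw [hsucc]; exact (le_max_left _ _).trans_lt (hp _ _)
  · rintro _ ⟨m, rfl⟩ _ ⟨n, rfl⟩ hne
    rcases lt_trichotomy m n with h | rfl | h
    · exact Or.inl (hlt m n h)
    · exact absurd rfl hne
    · exact Or.inr (hlt n m h)

/-- Dropping the exceptional value from a dense set loses at most that value, since `{a}` is closed.
-/
lemma subset_closure_diff_singleton {E : Type*} [TopologicalSpace E] [T1Space E] {Y D : Set E}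
    {a : E} (hYD : Y ⊆ closure D) : Y \ {a} ⊆ closure (D \ {a}) := by
  rintro y ⟨hy, hya⟩
  have h1 : D ⊆ {a} ∪ D \ {a} := by rw [Set.union_sdiff_self]; exact Set.subset_union_right
  have h2 := closure_mono h1 (hYD hy)
  rw [closure_union, closure_singleton] at h2
  exact h2.resolve_left hya

/-- If no isolated point of `Y` is omitted by `f`, there are points of geometrically growing moduli
that `f` maps onto a dense subset of `Y`. -/
lemma exists_geometric_image_dense {f : ℂ → ℂ} {a : ℂ} {Y : Set ℂ}
    (hf : ∀ b ≠ a, ∀ R : ℝ, ∃ z, R < ‖z‖ ∧ f z = b)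
    (hY : a ∈ Y → a ∉ Set.range f → AccPt a (𝓟 Y)) :
    ∃ X : Set ℂ, X.Countable ∧ f '' X ⊆ Y ∧ Y ⊆ closure (f '' X) ∧
      ∀ x ∈ X, ∀ y ∈ X, x ≠ y → 2 * ‖x‖ ≤ ‖y‖ ∨ 2 * ‖y‖ ≤ ‖x‖ := by
  obtain ⟨D, hDY, hDc, hYD⟩ :=
    (TopologicalSpace.IsSeparable.of_separableSpace Y).exists_countable_dense_subset
  have hdiff := fun R => exists_geometric_image_eq (D := D \ {a}) (hDc.mono Set.sdiff_subset)
    (fun d hd => hf d hd.2) R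
  -- The value `a` may be attained only near the origin, so one preimage `x₀` comes first and all
  -- others lie beyond `2 * ‖x₀‖`.
  by_cases haf : a ∈ D ∧ a ∈ Set.range f
  · obtain ⟨haD, x₀, hx₀⟩ := haf
    obtain ⟨X, hXc, hXD, hXR, hX⟩ := hdiff (2 * ‖x₀‖)
    have himg : f '' insert x₀ X = D := by
      rw [Set.image_insert_eq, hXD, hx₀, Set.insert_sdiff_singleton, Set.insert_eq_of_mem haD]
    refine ⟨insert x₀ X, hXc.insert _, himg.trans_subset hDY, himg ▸ hYD, ?_⟩
    rintro x (rfl | hx) y (rfl | hy) hne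
    · exact absurd rfl hne
    · exact Or.inl (hXR y hy).le
    · exact Or.inr (hXR x hx).le
    · exact hX x hx y hy hne
  · obtain ⟨X, hXc, hXD, -, hX⟩ := hdiff 0
    refine ⟨X, hXc, hXD ▸ Set.sdiff_subset.trans hDY, hXD ▸ fun y hy => ?_, hX⟩
    by_cases hya : y = a
    · subst hya
      by_cases hyD : y ∈ D
      -- The exceptional value lies in the closure of `Y` without it, and that set is in the closure
      -- of `D` without it.
      · have hacc := hY hy fun h => haf ⟨hyD, h⟩
        rw [accPt_principal_iff_clusterPt, ← mem_closure_iff_clusterPt] at hacc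
        exact closure_minimal (subset_closure_diff_singleton hYD) isClosed_closure hacc
      · rw [Set.sdiff_singleton_eq_self hyD]
        exact hYD hy
    · exact subset_closure_diff_singleton hYD ⟨hy, hya⟩

/-- If the exceptional value `a` is an isolated point of `Y`, there are points of geometrically
growing moduli whose images are dense in `Y \ {a}`, together with a sequence converging to `a`. -/
lemma exists_geometric_image_isolated {f : ℂ → ℂ} {a : ℂ} {Y : Set ℂ}
    (hf : ∀ b ≠ a, ∀ R : ℝ, ∃ z, R < ‖z‖ ∧ f z = b) (ha : a ∈ Y) (hacc : ¬ AccPt a (𝓟 Y)) :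
    ∃ X : Set ℂ, X.Countable ∧ Y ⊆ closure (f '' X) ∧
      (∀ n, HasNagataCoverings Y n → HasNagataCoverings (f '' X) n) ∧
      ∀ x ∈ X, ∀ y ∈ X, x ≠ y → 2 * ‖x‖ ≤ ‖y‖ ∨ 2 * ‖y‖ ≤ ‖x‖ := by
  obtain ⟨D, hDY, hDc, hYD⟩ :=
    (TopologicalSpace.IsSeparable.of_separableSpace Y).exists_countable_dense_subset
  rw [accPt_iff_nhds] at hacc
  push Not at hacc
  obtain ⟨U, hU, hUY⟩ := hacc
  obtain ⟨ε, hε, hεU⟩ := Metric.mem_nhds_iff.1 hU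
  set δ := ε / 3 with hδ
  have hδpos : 0 < δ := by positivity
  have hiso : ∀ y ∈ Y, y ≠ a → 2 * δ < dist y a := by
    intro y hy hya
    by_contra! h
    exact hya (hUY y ⟨hεU (Metric.mem_ball.2 (by linarith)), hy⟩)
  -- The distances to `a` halve at each step, and no `g n` is the exceptional value, so all of them
  -- are attained far out.
  set g : ℕ → ℂ := fun n => a + ((δ * (1 / 2) ^ n : ℝ) : ℂ) with hg
  have hgd : ∀ n, dist (g n) a = δ * (1 / 2) ^ n := by
    intro n
    rw [hg, dist_eq_norm, add_sub_cancel_left, Complex.norm_real, Real.norm_of_nonneg]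
    positivity
  have hgne : ∀ n, g n ≠ a := fun n => by
    rw [← dist_pos, hgd]; positivity
  have hglim : Tendsto g atTop (𝓝 a) := by
    rw [tendsto_iff_dist_tendsto_zero]
    simp only [hgd]
    simpa using (tendsto_pow_atTop_nhds_zero_of_lt_one (r := (1 / 2 : ℝ)) (by norm_num)
      (by norm_num)).const_mul δ
  have hglt : ∀ m n, m < n → 2 * dist (g n) a ≤ dist (g m) a := by
    intro m n hmn
    rw [hgd, hgd]
    have h1 : (1 / 2 : ℝ) ^ n ≤ (1 / 2) ^ (m + 1) :=
      pow_le_pow_of_le_one (by norm_num) (by norm_num) hmn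
    rw [pow_succ] at h1
    nlinarith
  obtain ⟨X, hXc, hXD, -, hX⟩ := exists_geometric_image_eq (f := f) (D := D \ {a} ∪ Set.range g)
    ((hDc.mono Set.sdiff_subset).union (Set.countable_range g)) (by
      rintro d (hd | ⟨n, rfl⟩)
      · exact hf d hd.2
      · exact hf _ (hgne n)) 0
  refine ⟨X, hXc, ?_, fun n hn => ?_, hX⟩
  · rw [hXD, closure_union]
    intro y hy
    by_cases hya : y = a
    · exact Or.inr (hya ▸ mem_closure_of_tendsto hglim (Eventually.of_forall fun n => ⟨n, rfl⟩))
    · exact Or.inl (subset_closure_diff_singleton hYD ⟨hy, hya⟩)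
  · rw [hXD]
    refine (hn.replace_isolated ha hiso (G := Set.range g) ?_ ?_).mono
      (Set.union_subset_union_left _ (Set.sdiff_subset_sdiff_left hDY))
    · rintro _ ⟨n, rfl⟩
      rw [hgd]
      exact mul_le_of_le_one_right hδpos.le (pow_le_one₀ (by norm_num) (by norm_num))
    · rintro _ ⟨m, rfl⟩ _ ⟨n, rfl⟩ hne
      rcases lt_trichotomy m n with h | rfl | h
      · exact Or.inr (hglt m n h)
      · exact absurd rfl hne
      · exact Or.inl (hglt n m h)

theorem theorem1p2 (f : ℂ → ℂ) (hf : Differentiable ℂ f)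
    (hess : HasEssentialSingularityAtInfinity f) (Y : Set ℂ) (hY : Y.Nonempty) :
    ∃ X : Set ℂ, X.Countable ∧ nagataDim X = 0 ∧
      (∀ x ∈ X, ∀ x' ∈ X, x ≠ x' → 2 * ‖x‖ ≤ ‖x'‖ ∨ 2 * ‖x'‖ ≤ ‖x‖) ∧
      Y ⊆ closure (f '' X) ∧
      nagataDim (f '' X) = nagataDim Y ∧
      ((∀ y ∈ Y, y ∉ Set.range f → AccPt y (𝓟 Y)) → f '' X ⊆ Y) := by
  obtain ⟨a, ha⟩ := exists_forall_ne_exists_eq_of_essential hf hess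
  have hdim : ∀ X : Set ℂ, Y ⊆ closure (f '' X) →
      (∀ x ∈ X, ∀ y ∈ X, x ≠ y → 2 * ‖x‖ ≤ ‖y‖ ∨ 2 * ‖y‖ ≤ ‖x‖) → nagataDim X = 0 :=
    fun X hYX hX => nagataDim_eq_zero_of_geometric (a := 0)
      (Set.image_nonempty.1 (closure_nonempty_iff.1 (hY.mono hYX)))
      (by simpa only [dist_zero_right] using hX)
  -- Only `a` can be omitted, so this decides whether an isolated point of `Y` is omitted; if one
  -- is, the final implication is vacuous.
  by_cases h : a ∈ Y → a ∉ Set.range f → AccPt a (𝓟 Y)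
  · obtain ⟨X, hXc, hXY, hYX, hX⟩ := exists_geometric_image_dense ha h
    exact ⟨X, hXc, hdim X hYX hX, hX, hYX,
      nagataDim_congr fun n => ⟨.of_subset_closure hYX, .mono hXY⟩, fun _ => hXY⟩
  · push Not at h
    obtain ⟨haY, haf, hacc⟩ := h
    obtain ⟨X, hXc, hYX, hn, hX⟩ := exists_geometric_image_isolated ha haY hacc
    exact ⟨X, hXc, hdim X hYX hX, hX, hYX,
      nagataDim_congr fun n => ⟨.of_subset_closure hYX, hn n⟩,
      fun hall => absurd (hall a haY haf) hacc⟩
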